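/- Let $B^H=(B^H(t))_{t\ge 0}$ be a fractional Brownian motion with Hurst parameter $H\in(1/2,1)$, i.e. a centered Gaussian process with covariance $\mathbb E[B^H(s)B^H(t)]=\frac12\left(t^{2H}+s^{2H}-|t-s|^{2H}\right)$. Let $\kappa\ge 2H$, $\lambda>0$ and $\mu>0$ be such that either $\kappa>2H$, or $\kappa=2H$ and $-\lambda+\mu^2<0$. Let $f,g:[0,\infty)\times\mathbb R\to\mathbb R$ satisfy, for all $t>0$ and $x\in\mathbb R$, $$x f(t,x)\le -\lambda\kappa t^{\kappa-1}x^2,\qquad |g(t,x)|\le \mu|x|.$$ Fix a step size $\Delta t>0$ and a constant $X_0\in\mathbb R$, and put $t_n=n\Delta t$, $V_n^H=B^H(t_{n+1})-B^H(t_n)$. For $\theta\in[0,1]$, the stochastic theta method (STM) for the equation $dX(t)=f(t,X(t))\,dt+g(t,X(t))\,dB^H(t)$ is the implicit recursion $$X_{n+1}=X_n+\theta f(t_{n+1},X_{n+1})\Delta t+(1-\theta)f(t_n,X_n)\Delta t+g(t_n,X_n)V_n^H,\qquad n=0,1,2,\dots$$ The method is called mean square stable if every sequence of random variables $(X_n)$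 that starts at $X_0$ and satisfies this recursion almost surely has $\mathbb E|X_n|^2<\infty$ for all $n$ and $\lim_{n\to\infty}\mathbb E|X_n|^2=0$. Then: (i) The STM with $\theta=1$ (the backward Euler method) is mean square stable. (ii) If in addition there is a constant $\bar\lambda>0$ with $|f(t,x)|\le\bar\lambda\kappa t^{\kappa-1}|x|$ for all $t>0$ and $x\in\mathbb R$, then the STM is mean square stable for every $\theta$ with $$\frac{\sqrt6\,e\,\bar\lambda/\lambda}{\sqrt6\,e\,\bar\lambda/\lambda+1}\le\theta<1 .$$ -/

import Mathlib

open MeasureTheory ProbabilityTheory Filter Topology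
open scoped NNReal

/-- `B` is a fractional Brownian motion with Hurst parameter `H` under `P`: a centered Gaussian
process on `[0, ∞)` with covariance `(t^{2H} + s^{2H} - |t - s|^{2H}) / 2`. -/
structure IsFractionalBrownianMotion {Ω : Type*} [MeasurableSpace Ω] (H : ℝ)
    (B : ℝ≥0 → Ω → ℝ) (P : Measure Ω) : Prop where
  isGaussianProcess : IsGaussianProcess B P
  integral_eq_zero : ∀ t, ∫ ω, B t ω ∂P = 0
  covariance_eq : ∀ s t, cov[B s, B t; P] =
    ((t : ℝ) ^ (2 * H) + (s : ℝ) ^ (2 * H) - |(t : ℝ) - (s : ℝ)| ^ (2 * H)) / 2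

/-- The grid point `t_n = n Δt`. -/
def gridTime (dt : ℝ≥0) (n : ℕ) : ℝ≥0 := n * dt

/-- The increment `V_n = B(t_{n+1}) - B(t_n)`. -/
def gridIncrement {Ω : Type*} (B : ℝ≥0 → Ω → ℝ) (dt : ℝ≥0) (n : ℕ) (ω : Ω) : ℝ :=
  B (gridTime dt (n + 1)) ω - B (gridTime dt n) ω

/-- The sequence of random variables `X` is produced by the stochastic theta method with parameter
`θ` and step size `dt`, started at the constant `x₀`, for `dX = f(t,X) dt + g(t,X) dB`. The scheme
is implicit in `X (n + 1)`; any measurable choice of solutions is allowed. -/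
structure IsStochasticThetaMethod {Ω : Type*} [MeasurableSpace Ω] (P : Measure Ω)
    (f g : ℝ → ℝ → ℝ) (B : ℝ≥0 → Ω → ℝ) (θ : ℝ) (dt : ℝ≥0) (x₀ : ℝ) (X : ℕ → Ω → ℝ) : Prop where
  aemeasurable : ∀ n, AEMeasurable (X n) P
  initial : ∀ᵐ ω ∂P, X 0 ω = x₀
  step : ∀ n, ∀ᵐ ω ∂P,
    X (n + 1) ω = X n ω + θ * f (gridTime dt (n + 1)) (X (n + 1) ω) * dt
      + (1 - θ) * f (gridTime dt n) (X n ω) * dt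
      + g (gridTime dt n) (X n ω) * gridIncrement B dt n ω

/-- Mean square stability: all second moments are finite, and `E |X_n|² → 0`. -/
def MeanSquareStable {Ω : Type*} [MeasurableSpace Ω] (P : Measure Ω) (X : ℕ → Ω → ℝ) : Prop :=
  (∀ n, MemLp (X n) 2 P) ∧ Tendsto (fun n => ∫ ω, |X n ω| ^ 2 ∂P) atTop (𝓝 0)

/-- Monotone condition: `x f(t,x) ≤ -λ κ t^{κ-1} x²` for all `t > 0` and `x`. -/
def MonotoneCondition (κ lam : ℝ) (f : ℝ → ℝ → ℝ) : Prop :=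
  ∀ t x : ℝ, 0 < t → x * f t x ≤ -lam * κ * t ^ (κ - 1) * x ^ 2

/-- Linear growth of the drift: `|f(t,x)| ≤ Λ κ t^{κ-1} |x|` for all `t > 0` and `x`. -/
def DriftLinearGrowth (κ lamBar : ℝ) (f : ℝ → ℝ → ℝ) : Prop :=
  ∀ t x : ℝ, 0 < t → |f t x| ≤ lamBar * κ * t ^ (κ - 1) * |x|

/-- Uniform linear growth of the diffusion: `|g(t,x)| ≤ μ |x|` for all `t > 0` and `x`. -/
def UniformLinearGrowth (μ : ℝ) (g : ℝ → ℝ → ℝ) : Prop :=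
  ∀ t x : ℝ, 0 < t → |g t x| ≤ μ * |x|

/-- A telescoping bound for the increments of a convex power. -/
lemma rpow_sub_rpow_sub_one_le {p x : ℝ} (hp : 1 ≤ p) (hx : 1 ≤ x) :
    x ^ p - (x - 1) ^ p ≤ p * x ^ (p - 1) := by
  have hx0 : 0 < x := by linarith
  have h := one_add_mul_self_le_rpow_one_add (s := -x⁻¹)
    (by have := inv_le_one_of_one_le₀ hx; linarith) hp
  have e : x - 1 = x * (1 + -x⁻¹) := by field_simp; ring
  have h0 : 0 ≤ 1 + -x⁻¹ := by have := inv_le_one_of_one_le₀ hx; linarith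
  rw [e, Real.mul_rpow hx0.le h0, Real.rpow_sub_one hx0.ne']
  have hp0 : 0 ≤ x ^ p := by positivity
  have := mul_le_mul_of_nonneg_left h hp0
  have e2 : x ^ p * (1 + p * -x⁻¹) = x ^ p - p * (x ^ p / x) := by field_simp; ring
  linarith

/-- A telescoping bound for the increments of a concave power. -/
lemma le_rpow_sub_rpow_sub_one {q x : ℝ} (hq : 0 ≤ q) (hq1 : q ≤ 1) (hx : 1 ≤ x) :
    q * x ^ (q - 1) ≤ x ^ q - (x - 1) ^ q := by
  have hx0 : 0 < x := by linarith
  have h := rpow_one_add_le_one_add_mul_self (s := -x⁻¹)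
    (by have := inv_le_one_of_one_le₀ hx; linarith) hq hq1
  have e : x - 1 = x * (1 + -x⁻¹) := by field_simp; ring
  have h0 : 0 ≤ 1 + -x⁻¹ := by have := inv_le_one_of_one_le₀ hx; linarith
  rw [e, Real.mul_rpow hx0.le h0, Real.rpow_sub_one hx0.ne']
  have hp0 : 0 ≤ x ^ q := by positivity
  have := mul_le_mul_of_nonneg_left h hp0
  have e2 : x ^ q * (1 + q * -x⁻¹) = x ^ q - q * (x ^ q / x) := by field_simp; ring
  linarith

lemma sum_range_rpow_neg_le {s : ℝ} (hs : 0 ≤ s) (hs1 : s < 1) (n : ℕ) :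
    ∑ k ∈ Finset.range n, ((k : ℝ) + 1) ^ (-s) ≤ (n : ℝ) ^ (1 - s) / (1 - s) := by
  have hq : 0 < 1 - s := by linarith
  rw [le_div_iff₀ hq]
  induction n with
  | zero => simp; positivity
  | succ n ih =>
    have h := le_rpow_sub_rpow_sub_one hq.le (by linarith : 1 - s ≤ 1)
      (by have := Nat.cast_nonneg (α := ℝ) n; linarith : (1 : ℝ) ≤ (n : ℝ) + 1)
    rw [Finset.sum_range_succ, add_mul]
    push_cast
    have e : 1 - s - 1 = -s := by ring
    have e2 : (n : ℝ) + 1 - 1 = n := by ring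
    rw [e, e2] at h
    linarith

/-- If `c k = O(k ^ (-a))` with `0 < a < 1`, then `n ^ a ∑ c k ^ 2 = o(n)`. -/
lemma eventually_rpow_mul_sum_sq_le {a M : ℝ} (ha : 0 < a) (ha1 : a < 1) {c : ℕ → ℝ}
    (hc0 : ∀ k, 0 ≤ c k) (hc : ∀ k, c k ≤ M * ((k : ℝ) + 1) ^ (-a)) {δ : ℝ} (hδ : 0 < δ) :
    ∀ᶠ n : ℕ in atTop, (n : ℝ) ^ a * ∑ k ∈ Finset.range n, c k ^ 2 ≤ δ * n := by
  obtain ⟨s, has, hs1, hs2⟩ : ∃ s, a < s ∧ s < 1 ∧ s ≤ 2 * a := by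
    refine ⟨min (2 * a) ((1 + a) / 2), lt_min (by linarith) (by linarith),
      (min_le_right _ _).trans_lt (by linarith), min_le_left _ _⟩
  have hsq : ∀ k : ℕ, c k ^ 2 ≤ M ^ 2 * ((k : ℝ) + 1) ^ (-s) := by
    intro k
    have hk : (1 : ℝ) ≤ (k : ℝ) + 1 := by have := Nat.cast_nonneg (α := ℝ) k; linarith
    calc c k ^ 2 ≤ (M * ((k : ℝ) + 1) ^ (-a)) ^ 2 := by
          have := hc0 k; have := hc k; gcongr
      _ = M ^ 2 * ((k : ℝ) + 1) ^ (-(2 * a)) := by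
          rw [mul_pow, ← Real.rpow_mul_natCast (by linarith)]; congr 2; push_cast; ring
      _ ≤ _ := by
          gcongr
  have hlim : Tendsto (fun n : ℕ => M ^ 2 / (1 - s) * (n : ℝ) ^ (-(s - a))) atTop (𝓝 0) := by
    simpa using (((tendsto_rpow_neg_atTop (by linarith : 0 < s - a)).comp
      tendsto_natCast_atTop_atTop).const_mul (M ^ 2 / (1 - s)))
  filter_upwards [hlim.eventually_le_const hδ, eventually_gt_atTop 0] with n hn hn0
  have hn0' : (0 : ℝ) < n := by exact_mod_cast hn0
  calc (n : ℝ) ^ a * ∑ k ∈ Finset.range n, c k ^ 2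
      ≤ (n : ℝ) ^ a * (M ^ 2 * ((n : ℝ) ^ (1 - s) / (1 - s))) := by
        gcongr
        calc _ ≤ ∑ k ∈ Finset.range n, M ^ 2 * ((k : ℝ) + 1) ^ (-s) :=
              Finset.sum_le_sum fun k _ => hsq k
          _ ≤ _ := by
              rw [← Finset.mul_sum]
              gcongr
              exact sum_range_rpow_neg_le (by linarith) hs1 n
    _ = M ^ 2 / (1 - s) * (n : ℝ) ^ (-(s - a)) * n := by
        have e : (n : ℝ) ^ a * (n : ℝ) ^ (1 - s) = (n : ℝ) ^ (-(s - a)) * n := by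
          rw [← Real.rpow_add hn0', ← Real.rpow_add_one hn0'.ne']; congr 1; ring
        linear_combination (M ^ 2 / (1 - s)) * e
    _ ≤ δ * n := by gcongr

lemma exists_forall_prod_range_le {u : ℕ → ℝ} {A : ℝ} (hA : 1 ≤ A) (h0 : ∀ k, 0 ≤ u k)
    (h1 : ∀ k, u k ≤ A) (hu : ∀ᶠ k in atTop, u k ≤ 1) :
    ∃ K, 0 ≤ K ∧ ∀ n, ∏ k ∈ Finset.range n, u k ≤ K := by
  obtain ⟨N, hN⟩ := eventually_atTop.1 hu
  refine ⟨A ^ N, by positivity, fun n => ?_⟩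
  rcases le_total n N with h | h
  · calc _ ≤ ∏ k ∈ Finset.range n, A := Finset.prod_le_prod (fun k _ => h0 k) fun k _ => h1 k
      _ = A ^ n := by simp
      _ ≤ A ^ N := pow_le_pow_right₀ hA h
  · induction n, h using Nat.le_induction with
    | base =>
      calc _ ≤ ∏ k ∈ Finset.range N, A := Finset.prod_le_prod (fun k _ => h0 k) fun k _ => h1 k
        _ = A ^ N := by simp
    | succ n hn ih =>
      rw [Finset.prod_range_succ]
      exact (mul_le_of_le_one_right (Finset.prod_nonneg fun k _ => h0 k) (hN n hn)).trans ih

/-- Product bound times geometric decay beats a slower exponential. -/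
lemma tendsto_two_pow_mul_prod_sq_mul_exp {r S : ℕ → ℝ} (h0 : ∀ k, 0 ≤ r k) (h1 : ∀ k, r k ≤ 1)
    (hr : ∀ᶠ k in atTop, r k ≤ 1 / 2) (hS : ∀ᶠ n : ℕ in atTop, S n ≤ n / 4) :
    Tendsto (fun n => (∏ k ∈ Finset.range n, r k ^ 2) * (2 ^ n * Real.exp (S n))) atTop (𝓝 0) := by
  obtain ⟨K, hK0, hK⟩ := exists_forall_prod_range_le (u := fun k => 4 * r k ^ 2) (A := 4)
    (by norm_num) (fun k => by positivity) (fun k => by nlinarith [h0 k, h1 k])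
    (hr.mono fun k hk => by nlinarith [h0 k])
  have hexp : Real.exp (1 / 4) < 2 := by
    have h := Real.exp_one_lt_d9
    have : Real.exp (1 / 4) ≤ Real.exp (1 / 2) := Real.exp_le_exp.2 (by norm_num)
    have h2 : Real.exp (1 / 2) ^ 2 = Real.exp 1 := by rw [← Real.exp_nat_mul]; norm_num
    nlinarith [Real.exp_pos (1 / 2)]
  have hlim : Tendsto (fun n : ℕ => K * (Real.exp (1 / 4) / 2) ^ n) atTop (𝓝 0) := by
    simpa using (tendsto_pow_atTop_nhds_zero_of_lt_one (by positivity)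
      (by linarith : Real.exp (1 / 4) / 2 < 1)).const_mul K
  refine squeeze_zero' (.of_forall fun n => ?_) ?_ hlim
  · exact mul_nonneg (Finset.prod_nonneg fun k _ => by positivity) (by positivity)
  · filter_upwards [hS] with n hn
    have hprod := hK n
    rw [Finset.prod_mul_distrib, Finset.prod_const, Finset.card_range] at hprod
    have hp0 : 0 ≤ ∏ k ∈ Finset.range n, r k ^ 2 := Finset.prod_nonneg fun k _ => by positivity
    have he : Real.exp (S n) ≤ Real.exp (1 / 4) ^ n := by
      rw [← Real.exp_nat_mul]; exact Real.exp_le_exp.2 (by linarith)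
    calc _ ≤ (∏ k ∈ Finset.range n, r k ^ 2) * (2 ^ n * Real.exp (1 / 4) ^ n) := by gcongr
      _ = (4 ^ n * ∏ k ∈ Finset.range n, r k ^ 2) * (Real.exp (1 / 4) / 2) ^ n := by
          rw [div_pow, show (4 : ℝ) ^ n = 2 ^ n * 2 ^ n by rw [← mul_pow]; norm_num]
          field_simp
      _ ≤ _ := by gcongr

/-- Schur-type bound for a quadratic form with non-negative symmetric kernel. -/
lemma sum_sum_mul_le_of_row_sum_le {n : ℕ} {c : ℕ → ℝ} {K : ℕ → ℕ → ℝ} {R : ℝ}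
    (hK : ∀ j k, 0 ≤ K j k) (hsymm : ∀ j k, K j k = K k j)
    (hR : ∀ k < n, ∑ j ∈ Finset.range n, K j k ≤ R) :
    ∑ j ∈ Finset.range n, ∑ k ∈ Finset.range n, c j * c k * K j k ≤
      R * ∑ k ∈ Finset.range n, c k ^ 2 := by
  have h1 : ∑ k ∈ Finset.range n, ∑ j ∈ Finset.range n, c k ^ 2 * K j k ≤
      R * ∑ k ∈ Finset.range n, c k ^ 2 := by
    rw [Finset.mul_sum]
    refine Finset.sum_le_sum fun k hk => ?_
    rw [← Finset.mul_sum, mul_comm R]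
    exact mul_le_mul_of_nonneg_left (hR k (Finset.mem_range.1 hk)) (sq_nonneg _)
  have h2 : ∑ j ∈ Finset.range n, ∑ k ∈ Finset.range n, c j ^ 2 * K j k =
      ∑ k ∈ Finset.range n, ∑ j ∈ Finset.range n, c k ^ 2 * K j k :=
    Finset.sum_congr rfl fun j _ => Finset.sum_congr rfl fun k _ => by rw [hsymm]
  have h3 : ∑ j ∈ Finset.range n, ∑ k ∈ Finset.range n, c k ^ 2 * K j k =
      ∑ k ∈ Finset.range n, ∑ j ∈ Finset.range n, c k ^ 2 * K j k := Finset.sum_comm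
  have h4 : ∑ j ∈ Finset.range n, ∑ k ∈ Finset.range n, c j * c k * K j k ≤
      ∑ j ∈ Finset.range n, ∑ k ∈ Finset.range n,
        (c j ^ 2 * K j k + c k ^ 2 * K j k) / 2 :=
    Finset.sum_le_sum fun j _ => Finset.sum_le_sum fun k _ => by
      nlinarith [mul_nonneg (hK j k) (sq_nonneg (c j - c k))]
  simp_rw [← Finset.sum_div, Finset.sum_add_distrib] at h4
  linarith

lemma HasGaussianLaw.integrable_exp_and_integral_exp {Ω : Type*} [MeasurableSpace Ω]
    {P : Measure Ω} {Z : Ω → ℝ} (hZ : HasGaussianLaw Z P) (h0 : ∫ ω, Z ω ∂P = 0) :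
    Integrable (fun ω => Real.exp (Z ω)) P ∧
      ∫ ω, Real.exp (Z ω) ∂P = Real.exp (Var[Z; P] / 2) := by
  have hmap := hZ.map_eq_gaussianReal
  constructor
  · have h := integrable_exp_mul_gaussianReal (μ := P[Z]) (v := Var[Z; P].toNNReal) 1
    rw [← hmap] at h
    simpa [Function.comp_def] using h.comp_aemeasurable hZ.aemeasurable
  · have h := mgf_gaussianReal hmap 1
    simpa [mgf, h0, variance_nonneg] using h

/-- Exponential moments of a weighted sum of absolute values of jointly Gaussian variables. -/
lemma IsGaussianProcess.integral_prod_exp_abs_le {Ω : Type*} [MeasurableSpace Ω]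
    {P : Measure Ω} {V : ℕ → Ω → ℝ} (hV : IsGaussianProcess V P)
    (h0 : ∀ k, ∫ ω, V k ω ∂P = 0) (hcov : ∀ j k, 0 ≤ cov[V j, V k; P])
    {c : ℕ → ℝ} (hc : ∀ k, 0 ≤ c k) (n : ℕ) :
    Integrable (fun ω => ∏ k ∈ Finset.range n, Real.exp (c k * |V k ω|)) P ∧
    ∫ ω, ∏ k ∈ Finset.range n, Real.exp (c k * |V k ω|) ∂P ≤
      2 ^ n * Real.exp ((∑ j ∈ Finset.range n, ∑ k ∈ Finset.range n,
        c j * c k * cov[V j, V k; P]) / 2) := by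
  have := hV.isProbabilityMeasure
  set S := ∑ j ∈ Finset.range n, ∑ k ∈ Finset.range n, c j * c k * cov[V j, V k; P]
  have hLp : ∀ k, MemLp (V k) 2 P := fun k => (hV.hasGaussianLaw_eval k).memLp_two
  let σ : Finset ℕ → ℕ → ℝ := fun t k => if k ∈ t then c k else -c k
  have hσ : ∀ t j k, σ t j * σ t k * cov[V j, V k; P] ≤ c j * c k * cov[V j, V k; P] := by
    intro t j k
    have := mul_nonneg (hc j) (hc k)
    refine mul_le_mul_of_nonneg_right ?_ (hcov j k)
    simp only [σ]
    split_ifs <;> nlinarith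
  let Z : Finset ℕ → Ω → ℝ := fun t ω => ∑ k ∈ Finset.range n, σ t k * V k ω
  have hZ : ∀ t, HasGaussianLaw (Z t) P := fun t =>
    (hV.smul (σ t)).hasGaussianLaw_fun_sum (I := Finset.range n)
  have hZ0 : ∀ t, ∫ ω, Z t ω ∂P = 0 := fun t => by
    simp only [Z]
    rw [integral_finsetSum _ fun k _ => ((hLp k).integrable (by norm_num)).const_mul _]
    simp [integral_const_mul, h0]
  have hZvar : ∀ t, Var[Z t; P] ≤ S := fun t => by
    simp only [Z]
    rw [variance_fun_sum' fun k _ => (hLp k).const_mul (σ t k)]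
    refine Finset.sum_le_sum fun j _ => Finset.sum_le_sum fun k _ => ?_
    rw [covariance_const_mul_left, covariance_const_mul_right, ← mul_assoc]
    exact hσ t j k
  have hexp := fun t => HasGaussianLaw.integrable_exp_and_integral_exp (hZ t) (hZ0 t)
  have hle : ∀ ω, ∏ k ∈ Finset.range n, Real.exp (c k * |V k ω|) ≤
      ∑ t ∈ (Finset.range n).powerset, Real.exp (Z t ω) := by
    intro ω
    calc _ ≤ ∏ k ∈ Finset.range n, (Real.exp (c k * V k ω) + Real.exp (-c k * V k ω)) := by
          refine Finset.prod_le_prod (fun k _ => (Real.exp_pos _).le) fun k _ => ?_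
          rcases abs_cases (V k ω) with ⟨h, -⟩ | ⟨h, -⟩ <;> rw [h]
          · exact le_add_of_nonneg_right (Real.exp_pos _).le
          · rw [mul_neg, ← neg_mul]
            exact le_add_of_nonneg_left (Real.exp_pos _).le
      _ = _ := by
          rw [Finset.prod_add]
          refine Finset.sum_congr rfl fun t ht => ?_
          rw [← Real.exp_sum, ← Real.exp_sum, ← Real.exp_add]
          congr 1
          simp only [Z]
          rw [← Finset.sum_sdiff (Finset.mem_powerset.1 ht), add_comm]
          congr 1
          · exact Finset.sum_congr rfl fun k hk => by simp [σ, (Finset.mem_sdiff.1 hk).2]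
          · exact Finset.sum_congr rfl fun k hk => by simp [σ, hk]
  have hint : Integrable (fun ω => ∑ t ∈ (Finset.range n).powerset, Real.exp (Z t ω)) P :=
    integrable_finsetSum _ fun t _ => (hexp t).1
  have hint' : Integrable (fun ω => ∏ k ∈ Finset.range n, Real.exp (c k * |V k ω|)) P := by
    refine hint.mono' ?_ (.of_forall fun ω => ?_)
    · have hm : ∀ k, AEMeasurable (V k) P := hV.aemeasurable
      exact (Finset.aemeasurable_fun_prod _ fun k _ =>
        ((hm k).norm.const_mul (c k)).exp).aestronglyMeasurable
    · rw [Real.norm_of_nonneg (Finset.prod_nonneg fun k _ => (Real.exp_pos _).le)]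
      exact hle ω
  refine ⟨hint', ?_⟩
  calc _ ≤ ∫ ω, ∑ t ∈ (Finset.range n).powerset, Real.exp (Z t ω) ∂P :=
        integral_mono hint' hint hle
    _ = ∑ t ∈ (Finset.range n).powerset, Real.exp (Var[Z t; P] / 2) := by
        rw [integral_finsetSum _ fun t _ => (hexp t).1]
        exact Finset.sum_congr rfl fun t _ => (hexp t).2
    _ ≤ ∑ t ∈ (Finset.range n).powerset, Real.exp (S / 2) :=
        Finset.sum_le_sum fun t _ => Real.exp_le_exp.2 (by linarith [hZvar t])
    _ = _ := by simp

namespace IsFractionalBrownianMotion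

variable {Ω : Type*} [MeasurableSpace Ω] {P : Measure Ω} {H : ℝ} {B : ℝ≥0 → Ω → ℝ}

lemma isGaussianProcess_gridIncrement (hB : IsFractionalBrownianMotion H B P) (dt : ℝ≥0) :
    IsGaussianProcess (gridIncrement B dt) P := by
  classical
  exact hB.isGaussianProcess.of_isGaussianProcess fun n =>
    ⟨{gridTime dt (n + 1), gridTime dt n},
      { toFun x := x ⟨gridTime dt (n + 1), by simp⟩ - x ⟨gridTime dt n, by simp⟩
        map_add' x y := by simp; ring
        map_smul' m x := by simp; ring },
      fun ω => rfl⟩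

lemma integral_gridIncrement (hB : IsFractionalBrownianMotion H B P) (dt : ℝ≥0) (n : ℕ) :
    ∫ ω, gridIncrement B dt n ω ∂P = 0 := by
  simp only [gridIncrement]
  rw [integral_sub (hB.isGaussianProcess.hasGaussianLaw_eval _).integrable
    (hB.isGaussianProcess.hasGaussianLaw_eval _).integrable]
  simp [hB.integral_eq_zero]

lemma covariance_gridIncrement (hB : IsFractionalBrownianMotion H B P) (dt : ℝ≥0) (j k : ℕ) :
    cov[gridIncrement B dt j, gridIncrement B dt k; P] =
      (dt : ℝ) ^ (2 * H) / 2 * (|(j : ℝ) - k + 1| ^ (2 * H) - 2 * |(j : ℝ) - k| ^ (2 * H)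
        + |(j : ℝ) - k - 1| ^ (2 * H)) := by
  have := hB.isGaussianProcess.isProbabilityMeasure
  have hLp : ∀ t, MemLp (B t) 2 P := fun t =>
    (hB.isGaussianProcess.hasGaussianLaw_eval t).memLp_two
  have e : ∀ n, gridIncrement B dt n = B (gridTime dt (n + 1)) - B (gridTime dt n) :=
    fun n => rfl
  have habs : ∀ x : ℝ, |x * dt| ^ (2 * H) = (dt : ℝ) ^ (2 * H) * |x| ^ (2 * H) := fun x => by
    rw [abs_mul, Real.mul_rpow (abs_nonneg _) (abs_nonneg _), mul_comm,
      abs_of_nonneg dt.coe_nonneg]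
  rw [e, e, covariance_sub_left (hLp _) (hLp _) ((hLp _).sub (hLp _)),
    covariance_sub_right (hLp _) (hLp _) (hLp _), covariance_sub_right (hLp _) (hLp _) (hLp _)]
  simp only [hB.covariance_eq, gridTime]
  push_cast
  have h1 : ((k : ℝ) + 1) * dt - ((j : ℝ) + 1) * dt = -((j : ℝ) - k) * dt := by ring
  have h2 : (k : ℝ) * dt - ((j : ℝ) + 1) * dt = -((j : ℝ) - k + 1) * dt := by ring
  have h3 : ((k : ℝ) + 1) * dt - (j : ℝ) * dt = -((j : ℝ) - k - 1) * dt := by ring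
  have h4 : (k : ℝ) * dt - (j : ℝ) * dt = -((j : ℝ) - k) * dt := by ring
  rw [h1, h2, h3, h4]
  simp only [habs, abs_neg]
  ring

lemma covariance_gridIncrement_nonneg (hB : IsFractionalBrownianMotion H B P)
    (hH : 1 / 2 ≤ H) (dt : ℝ≥0) (j k : ℕ) :
    0 ≤ cov[gridIncrement B dt j, gridIncrement B dt k; P] := by
  rw [hB.covariance_gridIncrement]
  refine mul_nonneg (by positivity) ?_
  set x : ℝ := (j : ℝ) - k
  have hp : 1 ≤ 2 * H := by linarith
  have hconv := (convexOn_rpow hp).2 (abs_nonneg (x + 1)) (abs_nonneg (x - 1))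
    (by norm_num : (0 : ℝ) ≤ 1 / 2) (by norm_num : (0 : ℝ) ≤ 1 / 2) (by norm_num)
  have hmono : |x| ^ (2 * H) ≤ ((1 / 2 : ℝ) • |x + 1| + (1 / 2 : ℝ) • |x - 1|) ^ (2 * H) := by
    refine Real.rpow_le_rpow (abs_nonneg _) ?_ (by linarith)
    simp only [smul_eq_mul]
    have := abs_add_le (x + 1) (x - 1)
    rw [show x + 1 + (x - 1) = 2 * x by ring, abs_mul, abs_two] at this
    linarith
  simp only [smul_eq_mul] at hconv hmono
  linarith

lemma sum_covariance_gridIncrement_le (hB : IsFractionalBrownianMotion H B P)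
    (hH : 1 / 2 ≤ H) (dt : ℝ≥0) {n k : ℕ} (hk : k < n) :
    ∑ j ∈ Finset.range n, cov[gridIncrement B dt j, gridIncrement B dt k; P] ≤
      (dt : ℝ) ^ (2 * H) * (2 * H) * (n : ℝ) ^ (2 * H - 1) := by
  let u : ℕ → ℝ := fun j => |(j : ℝ) - k| ^ (2 * H) - |(j : ℝ) - k - 1| ^ (2 * H)
  have hsum : ∑ j ∈ Finset.range n, cov[gridIncrement B dt j, gridIncrement B dt k; P] =
      (dt : ℝ) ^ (2 * H) / 2 * (u n - u 0) := by
    rw [← Finset.sum_range_sub, Finset.mul_sum]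
    refine Finset.sum_congr rfl fun j _ => ?_
    rw [hB.covariance_gridIncrement]
    simp only [u]
    push_cast
    rw [show (j : ℝ) + 1 - k = j - k + 1 by ring, show (j : ℝ) - k + 1 - 1 = j - k by ring]
    ring
  have hkn : (k : ℝ) + 1 ≤ n := by exact_mod_cast hk
  have hk0 : (0 : ℝ) ≤ k := Nat.cast_nonneg k
  have hp : 1 ≤ 2 * H := by linarith
  have hmono : ∀ x : ℝ, 1 ≤ x → x ≤ n →
      x ^ (2 * H) - (x - 1) ^ (2 * H) ≤ 2 * H * (n : ℝ) ^ (2 * H - 1) := fun x hx hxn =>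
    (rpow_sub_rpow_sub_one_le hp hx).trans <| by
      gcongr
  have h1 : u n ≤ 2 * H * (n : ℝ) ^ (2 * H - 1) := by
    simp only [u]
    rw [abs_of_nonneg (by linarith), abs_of_nonneg (by linarith)]
    exact hmono _ (by linarith) (by linarith)
  have h2 : -u 0 ≤ 2 * H * (n : ℝ) ^ (2 * H - 1) := by
    have := hmono (k + 1) (by linarith) hkn
    simp only [u, Nat.cast_zero]
    rw [abs_of_nonpos (by linarith), abs_of_nonpos (by linarith),
      show -(0 - (k : ℝ)) = k + 1 - 1 by ring, show -(0 - (k : ℝ) - 1) = k + 1 by ring]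
    linarith
  rw [hsum]
  have hD : 0 ≤ (dt : ℝ) ^ (2 * H) := by positivity
  have := mul_le_mul_of_nonneg_left (add_le_add h1 h2) hD
  linarith

end IsFractionalBrownianMotion

/-- Mean square stability from a pathwise product bound driven by increments of fractional
Brownian motion. -/
lemma IsFractionalBrownianMotion.meanSquareStable_of_abs_le_prod {Ω : Type*} [MeasurableSpace Ω]
    {P : Measure Ω} {H : ℝ} (hH : 1 / 2 < H) (hH1 : H < 1) {B : ℝ≥0 → Ω → ℝ}
    (hB : IsFractionalBrownianMotion H B P) {dt : ℝ≥0} {X : ℕ → Ω → ℝ}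
    (hX : ∀ n, AEMeasurable (X n) P) {r c : ℕ → ℝ} {C M : ℝ}
    (hr0 : ∀ k, 0 ≤ r k) (hr1 : ∀ k, r k ≤ 1) (hr : ∀ᶠ k in atTop, r k ≤ 1 / 2)
    (hc0 : ∀ k, 0 ≤ c k) (hc : ∀ k, c k ≤ M * ((k : ℝ) + 1) ^ (-(2 * H - 1)))
    (hbound : ∀ n, ∀ᵐ ω ∂P, |X n ω| ≤
      C * ∏ k ∈ Finset.range n, r k * Real.exp (c k * |gridIncrement B dt k ω|)) :
    MeanSquareStable P X := by
  set V := gridIncrement B dt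
  have hcov := hB.covariance_gridIncrement_nonneg hH.le dt
  set S : ℕ → ℝ := fun n => (∑ j ∈ Finset.range n, ∑ k ∈ Finset.range n,
    (2 * c j) * (2 * c k) * cov[V j, V k; P]) / 2
  have hmom := fun n => IsGaussianProcess.integral_prod_exp_abs_le
    (hB.isGaussianProcess_gridIncrement dt) (hB.integral_gridIncrement dt) hcov
    (c := fun k => 2 * c k) (fun k => mul_nonneg zero_le_two (hc0 k)) n
  have hS : ∀ᶠ n : ℕ in atTop, S n ≤ n / 4 := by
    set D : ℝ := (dt : ℝ) ^ (2 * H) * (2 * H)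
    have hD : 0 ≤ D := by positivity
    filter_upwards [eventually_rpow_mul_sum_sq_le (by linarith : 0 < 2 * H - 1) (by linarith)
      hc0 hc (δ := 1 / (8 * (D + 1))) (by positivity)] with n hn
    have h := sum_sum_mul_le_of_row_sum_le (c := fun k => 2 * c k) hcov
      (fun j k => covariance_comm _ _)
      (fun k hk => hB.sum_covariance_gridIncrement_le hH.le dt (n := n) hk)
    simp only [mul_pow, ← Finset.mul_sum] at h
    have h2 : S n ≤ 2 * (D * ((n : ℝ) ^ (2 * H - 1) * ∑ k ∈ Finset.range n, c k ^ 2)) := by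
      simp only [S]
      linarith
    have h3 : D * (1 / (8 * (D + 1)) * n) ≤ n / 8 := by
      rw [show D * (1 / (8 * (D + 1)) * (n : ℝ)) = D / (D + 1) * (n / 8) by field_simp]
      exact mul_le_of_le_one_left (by positivity) (div_le_one_of_le₀ (by linarith) (by linarith))
    have h4 := mul_le_mul_of_nonneg_left hn hD
    linarith
  have hsq : ∀ n, ∀ᵐ ω ∂P, X n ω ^ 2 ≤ (C ^ 2 * ∏ k ∈ Finset.range n, r k ^ 2) *
      ∏ k ∈ Finset.range n, Real.exp (2 * c k * |V k ω|) := by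
    intro n
    filter_upwards [hbound n] with ω hω
    rw [← sq_abs]
    refine (pow_le_pow_left₀ (abs_nonneg _) hω 2).trans_eq ?_
    rw [mul_pow, ← Finset.prod_pow, mul_assoc, ← Finset.prod_mul_distrib]
    congr 1
    refine Finset.prod_congr rfl fun k _ => ?_
    rw [mul_pow, ← Real.exp_nat_mul]
    congr 2
    push_cast
    ring
  have hint : ∀ n, Integrable (fun ω => X n ω ^ 2) P := fun n =>
    ((hmom n).1.const_mul _).mono' ((hX n).pow_const 2).aestronglyMeasurable <| by
      filter_upwards [hsq n] with ω hω
      rwa [Real.norm_of_nonneg (sq_nonneg _)]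
  refine ⟨fun n => (memLp_two_iff_integrable_sq (hX n).aestronglyMeasurable).2 (hint n), ?_⟩
  simp only [sq_abs]
  have hlim := (tendsto_two_pow_mul_prod_sq_mul_exp hr0 hr1 hr hS).const_mul (C ^ 2)
  rw [mul_zero] at hlim
  refine squeeze_zero (fun n => integral_nonneg fun ω => sq_nonneg _) (fun n => ?_) hlim
  calc _ ≤ ∫ ω, (C ^ 2 * ∏ k ∈ Finset.range n, r k ^ 2) *
        ∏ k ∈ Finset.range n, Real.exp (2 * c k * |V k ω|) ∂P :=
        integral_mono_ae (hint n) ((hmom n).1.const_mul _) (hsq n)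
    _ ≤ (C ^ 2 * ∏ k ∈ Finset.range n, r k ^ 2) * (2 ^ n * Real.exp (S n)) := by
        rw [integral_const_mul]
        exact mul_le_mul_of_nonneg_left (hmom n).2
          (mul_nonneg (sq_nonneg C) (Finset.prod_nonneg fun k _ => sq_nonneg _))
    _ = _ := by ring

/-- One implicit step contracts: the resolvent bound of a monotone drift. -/
lemma abs_mul_one_add_le_of_implicit_step {x y F L d : ℝ} (hd : 0 ≤ d)
    (hF : x * F ≤ -L * x ^ 2) (hstep : x = y + F * d) : |x| * (1 + L * d) ≤ |y| := by
  rcases eq_or_ne x 0 with rfl | hx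
  · simp
  have hx0 : 0 < |x| := abs_pos.2 hx
  have h1 : x ^ 2 * (1 + L * d) ≤ x * y := by
    have e : x * x = x * y + x * F * d := by
      nth_rewrite 2 [hstep]; ring
    nlinarith [mul_le_mul_of_nonneg_right hF hd]
  have h2 : x * y ≤ |x| * |y| := by rw [← abs_mul]; exact le_abs_self _
  rw [← sq_abs] at h1
  refine le_of_mul_le_mul_left ?_ hx0
  nlinarith

lemma one_add_div_four_add_le_mul_exp {b v : ℝ} (hb : 0 ≤ b) :
    1 + b / 4 + v ≤ (1 + b / 4) * Real.exp (v / (1 + b / 4)) := by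
  have h : 0 < 1 + b / 4 := by positivity
  calc 1 + b / 4 + v = (1 + b / 4) * (v / (1 + b / 4) + 1) := by field_simp; ring
    _ ≤ _ := by gcongr; exact Real.add_one_le_exp _

/-- The theta method is mean square stable as soon as its explicit part is dominated by a quarter
of its implicit part. -/
lemma IsStochasticThetaMethod.meanSquareStable {Ω : Type*} [MeasurableSpace Ω] {P : Measure Ω}
    {H : ℝ} (hH : 1 / 2 < H) (hH1 : H < 1) {B : ℝ≥0 → Ω → ℝ}
    (hB : IsFractionalBrownianMotion H B P) {κ lam μ : ℝ} (hκ : 2 * H ≤ κ) (hlam : 0 < lam)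
    (hμ : 0 < μ) {f g : ℝ → ℝ → ℝ} (hf : MonotoneCondition κ lam f)
    (hg : UniformLinearGrowth μ g) {dt : ℝ≥0} (hdt : 0 < dt) {x₀ θ : ℝ} (hθ : 0 < θ)
    (hexplicit : ∀ t x : ℝ, 0 < t →
      |(1 - θ) * f t x| ≤ θ / 4 * (lam * κ * t ^ (κ - 1)) * |x|)
    {X : ℕ → Ω → ℝ} (hX : IsStochasticThetaMethod P f g B θ dt x₀ X) :
    MeanSquareStable P X := by
  have hd : (0 : ℝ) < dt := hdt
  have hκ1 : 1 < κ := by linarith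
  have hκ0 : 0 < κ := by linarith
  set t : ℕ → ℝ := fun n => (gridTime dt n : ℝ) with ht
  have htn : ∀ n, t n = n * dt := fun n => by simp [ht, gridTime]
  have ht0 : ∀ n, 0 ≤ t n := fun n => by rw [htn]; positivity
  have htpos : ∀ n, 0 < t (n + 1) := fun n => by rw [htn]; push_cast; positivity
  set b : ℕ → ℝ := fun n => θ * (lam * κ * t n ^ (κ - 1)) * dt with hb
  have hb0 : ∀ n, 0 ≤ b n := fun n => by
    have := Real.rpow_nonneg (ht0 n) (κ - 1)
    simp only [hb]; positivity
  have hbmono : ∀ n, b n ≤ b (n + 1) := fun n => by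
    have : t n ≤ t (n + 1) := by rw [htn, htn]; push_cast; nlinarith
    have := Real.rpow_le_rpow (ht0 n) this (by linarith : 0 ≤ κ - 1)
    simp only [hb]; gcongr
  have hbzero : b 0 = 0 := by
    simp only [hb, htn]
    rw [Nat.cast_zero, zero_mul, Real.zero_rpow (by linarith)]
    ring
  set β : ℝ := θ * (lam * κ * (dt : ℝ) ^ (κ - 1)) * dt with hβ
  have hβ0 : 0 < β := by positivity
  have hbβ : ∀ n : ℕ, β * (n : ℝ) ^ (2 * H - 1) ≤ b n := fun n => by
    have h1 : (n : ℝ) ^ (2 * H - 1) ≤ (n : ℝ) ^ (κ - 1) := by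
      rcases Nat.eq_zero_or_pos n with rfl | hn
      · rw [Nat.cast_zero, Real.zero_rpow (by linarith), Real.zero_rpow (by linarith)]
      · exact Real.rpow_le_rpow_of_exponent_le (by exact_mod_cast hn) (by linarith)
    calc _ ≤ β * (n : ℝ) ^ (κ - 1) := by gcongr
      _ = b n := by
        simp only [hb, hβ, htn]
        rw [Real.mul_rpow (Nat.cast_nonneg n) hd.le]
        ring
  set r : ℕ → ℝ := fun n => (1 + b n / 4) / (1 + b n) with hr
  set c : ℕ → ℝ := fun n => μ / (1 + b n / 4) with hc
  have hr0 : ∀ n, 0 ≤ r n := fun n => by have := hb0 n; simp only [hr]; positivity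
  have hc0 : ∀ n, 0 ≤ c n := fun n => by have := hb0 n; simp only [hc]; positivity
  set m : ℝ := min 1 (β / 4) with hm
  have hm0 : 0 < m := by positivity
  have hstepbound : ∀ (n : ℕ) (z v A : ℝ), 0 ≤ A → |z| * (1 + b n) ≤ A * (1 + b n / 4 + μ * v) →
      |z| ≤ A * (r n * Real.exp (c n * v)) := by
    intro n z v A hA h
    have hbn := hb0 n
    have h1 := mul_le_mul_of_nonneg_left (one_add_div_four_add_le_mul_exp (v := μ * v) hbn) hA
    have h2 : |z| ≤ A * ((1 + b n / 4) * Real.exp (μ * v / (1 + b n / 4))) / (1 + b n) := by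
      rw [le_div_iff₀ (by positivity)]; exact h.trans h1
    refine h2.trans_eq ?_
    simp only [hr, hc]
    rw [div_mul_eq_mul_div μ]
    ring
  set C : ℝ := |x₀| + |x₀ + (1 - θ) * f (t 0) x₀ * dt| + |g (t 0) x₀| / μ with hC
  have hC0 : 0 ≤ C := by positivity
  have hcontract : ∀ n, ∀ᵐ ω ∂P, |X (n + 1) ω| * (1 + b n) ≤
      |X n ω + (1 - θ) * f (t n) (X n ω) * dt + g (t n) (X n ω) * gridIncrement B dt n ω| := by
    intro n
    filter_upwards [hX.step n] with ω hω
    have h := abs_mul_one_add_le_of_implicit_step (x := X (n + 1) ω)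
      (y := X n ω + (1 - θ) * f (t n) (X n ω) * dt + g (t n) (X n ω) * gridIncrement B dt n ω)
      (F := θ * f (t (n + 1)) (X (n + 1) ω)) (L := θ * (lam * κ * t (n + 1) ^ (κ - 1)))
      hd.le
      (by nlinarith [mul_le_mul_of_nonneg_left (hf (t (n + 1)) (X (n + 1) ω) (htpos n)) hθ.le])
      (by simp only [ht]; linarith)
    refine le_trans ?_ h
    have := hbmono n
    gcongr
  refine hB.meanSquareStable_of_abs_le_prod hH hH1 hX.aemeasurable (r := r) (c := c) (C := C)
    (M := μ / m) (dt := dt) hr0 (fun n => ?_) ?_ hc0 (fun n => ?_) (fun n => ?_)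
  · have := hb0 n
    exact div_le_one_of_le₀ (by linarith) (by linarith)
  · have hlim : Tendsto (fun n : ℕ => β * (n : ℝ) ^ (2 * H - 1)) atTop atTop :=
      ((tendsto_rpow_atTop (by linarith)).comp tendsto_natCast_atTop_atTop).const_mul_atTop hβ0
    filter_upwards [hlim.eventually_ge_atTop 2] with n hn
    have := hbβ n
    simp only [hr]
    rw [div_le_iff₀ (by linarith)]
    linarith
  · have hpow : ((n : ℝ) + 1) ^ (2 * H - 1) ≤ (n : ℝ) ^ (2 * H - 1) + 1 := by
      simpa using Real.rpow_add_le_add_rpow (Nat.cast_nonneg n) zero_le_one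
        (by linarith : 0 ≤ 2 * H - 1) (by linarith)
    have hn0 : (0 : ℝ) ≤ (n : ℝ) ^ (2 * H - 1) := by positivity
    have hlow : m * ((n : ℝ) + 1) ^ (2 * H - 1) ≤ 1 + b n / 4 := by
      have h1 : m ≤ 1 := min_le_left _ _
      have h2 : m ≤ β / 4 := min_le_right _ _
      have := hbβ n
      nlinarith [mul_le_mul_of_nonneg_left hpow hm0.le, mul_le_mul_of_nonneg_right h2 hn0]
    rw [Real.rpow_neg (by positivity), ← div_eq_mul_inv, div_div]
    exact div_le_div_of_nonneg_left hμ.le (by positivity) hlow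
  · induction n with
    | zero =>
      filter_upwards [hX.initial] with ω hω
      have : 0 ≤ |g (t 0) x₀| / μ := by positivity
      simp only [Finset.range_zero, Finset.prod_empty, mul_one, hω, hC]
      linarith [abs_nonneg (x₀ + (1 - θ) * f (t 0) x₀ * dt)]
    | succ n ih =>
      filter_upwards [ih, hX.initial, hcontract n] with ω hω hinit hn
      rw [Finset.prod_range_succ, ← mul_assoc]
      set v := gridIncrement B dt n ω
      rcases n with _ | n
      · rw [Finset.range_zero, Finset.prod_empty, mul_one]
        refine hstepbound 0 _ _ _ hC0 (hn.trans ?_)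
        rw [hinit, hbzero]
        have h1 := abs_add_le (x₀ + (1 - θ) * f (t 0) x₀ * dt) (g (t 0) x₀ * v)
        rw [abs_mul (g _ _)] at h1
        have h2 : |g (t 0) x₀| = |g (t 0) x₀| / μ * μ := by field_simp
        have h3 : |g (t 0) x₀| * |v| ≤ C * (μ * |v|) := by
          rw [h2, mul_assoc]
          refine mul_le_mul_of_nonneg_right ?_ (by positivity)
          simp only [hC]
          linarith [abs_nonneg x₀, abs_nonneg (x₀ + (1 - θ) * f (t 0) x₀ * dt)]
        have h4 : |x₀ + (1 - θ) * f (t 0) x₀ * dt| ≤ C := by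
          have : 0 ≤ |g (t 0) x₀| / μ := by positivity
          simp only [hC]
          linarith [abs_nonneg x₀]
        linarith
      · have h0 : 0 ≤ r (n + 1) * Real.exp (c (n + 1) * |v|) :=
          mul_nonneg (hr0 _) (Real.exp_pos _).le
        refine le_trans ?_ (mul_le_mul_of_nonneg_right hω h0)
        refine hstepbound (n + 1) _ _ _ (abs_nonneg _) (hn.trans ?_)
        set x := X (n + 1) ω
        have h1 := abs_add_three x ((1 - θ) * f (t (n + 1)) x * dt) (g (t (n + 1)) x * v)
        rw [abs_mul _ (dt : ℝ), abs_of_pos hd, abs_mul (g _ _)] at h1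
        have h2 := mul_le_mul_of_nonneg_right (hexplicit (t (n + 1)) x (htpos n)) hd.le
        have h3 := mul_le_mul_of_nonneg_right (hg (t (n + 1)) x (htpos n)) (abs_nonneg v)
        have h4 : θ / 4 * (lam * κ * t (n + 1) ^ (κ - 1)) * |x| * dt = |x| * (b (n + 1) / 4) := by
          simp only [hb]; ring
        linarith

lemma one_sub_mul_le_of_le_theta {lam lamBar θ : ℝ} (hlam : 0 < lam) (hlamBar : 0 < lamBar)
    (h : √6 * Real.exp 1 * (lamBar / lam) / (√6 * Real.exp 1 * (lamBar / lam) + 1) ≤ θ)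
    (hθ1 : θ < 1) : (1 - θ) * lamBar ≤ θ / 4 * lam := by
  have h6 : 2 ≤ √6 := Real.le_sqrt_of_sq_le (by norm_num)
  have he : 2 ≤ Real.exp 1 := by linarith [Real.exp_one_gt_d9]
  have h4 : 4 ≤ √6 * Real.exp 1 := by nlinarith
  set q := √6 * Real.exp 1
  rw [div_le_iff₀ (by positivity)] at h
  have e : lamBar / lam * lam = lamBar := by field_simp
  have hρ : 0 < lamBar / lam := by positivity
  have h5 : 4 * (lamBar / lam) * (1 - θ) ≤ θ := by
    nlinarith [mul_le_mul_of_nonneg_right h4 (mul_nonneg hρ.le (by linarith : 0 ≤ 1 - θ))]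
  have h6 := mul_le_mul_of_nonneg_right h5 hlam.le
  nlinarith

theorem theorem2 {Ω : Type*} [MeasurableSpace Ω] (P : Measure Ω) [IsProbabilityMeasure P]
    (H : ℝ) (hH : 1 / 2 < H) (hH1 : H < 1)
    (B : ℝ≥0 → Ω → ℝ) (hB : IsFractionalBrownianMotion H B P)
    (κ lam μ : ℝ) (hκ : 2 * H ≤ κ) (hlam : 0 < lam) (hμ : 0 < μ)
    (hstab : (2 * H < κ ∧ 0 < lam) ∨ (κ = 2 * H ∧ -lam + μ ^ 2 < 0))
    (f g : ℝ → ℝ → ℝ) (hf : MonotoneCondition κ lam f) (hg : UniformLinearGrowth μ g)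
    (dt : ℝ≥0) (hdt : 0 < dt) (x₀ : ℝ) :
    (∀ X : ℕ → Ω → ℝ, IsStochasticThetaMethod P f g B 1 dt x₀ X → MeanSquareStable P X) ∧
    (∀ lamBar : ℝ, 0 < lamBar → DriftLinearGrowth κ lamBar f →
      ∀ θ : ℝ, √6 * Real.exp 1 * (lamBar / lam) / (√6 * Real.exp 1 * (lamBar / lam) + 1) ≤ θ →
        θ < 1 →
        ∀ X : ℕ → Ω → ℝ, IsStochasticThetaMethod P f g B θ dt x₀ X → MeanSquareStable P X) := by
  have hκ0 : 0 < κ := by linarith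
  constructor
  · intro X hX
    refine IsStochasticThetaMethod.meanSquareStable hH hH1 hB hκ hlam hμ hf hg hdt one_pos
      (fun t x ht => ?_) hX
    simp only [sub_self, zero_mul, abs_zero]
    positivity
  · intro lamBar hlamBar hgrowth θ hθ hθ1 X hX
    have hθ0 : 0 < θ := lt_of_lt_of_le (by positivity) hθ
    refine IsStochasticThetaMethod.meanSquareStable hH hH1 hB hκ hlam hμ hf hg hdt hθ0
      (fun t x ht => ?_) hX
    have hdom := one_sub_mul_le_of_le_theta hlam hlamBar hθ hθ1
    rw [abs_mul, abs_of_pos (by linarith : 0 < 1 - θ)]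
    calc (1 - θ) * |f t x| ≤ (1 - θ) * (lamBar * κ * t ^ (κ - 1) * |x|) :=
          mul_le_mul_of_nonneg_left (hgrowth t x ht) (by linarith)
      _ = (1 - θ) * lamBar * (κ * t ^ (κ - 1) * |x|) := by ring
      _ ≤ θ / 4 * lam * (κ * t ^ (κ - 1) * |x|) := by gcongr
      _ = _ := by ring
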